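/- Let $K$ be a field of characteristic zero. The Riordan group $\mathcal R(K)$ is the group, under matrix multiplication, of the infinite lower triangular matrices $(d_{i,j})_{i,j\ge 0}$ with entries $d_{i,j}=[x^i]\,d(x)h(x)^j$, where $d,h\in K[[x]]$ satisfy $d(0)\neq 0$, $h(0)=0$ and $h'(0)\neq 0$. For $n\ge 1$, let $\mathcal R_n(K)\le GL(n+1,K)$ be the group of the truncations $(d_{i,j})_{0\le i,j\le n}$ of the elements of $\mathcal R(K)$. Let $G$ be either $\mathcal R(K)$ or $\mathcal R_n(K)$ with $n\ge 1$. Then every element of the subgroup of $G$ generated by the involutions (elements of order two) of $G$ is a product of at most four involutions of $G$. -/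

import Mathlib

open PowerSeries in
/-- The infinite matrix `(d, h)` with entries `d_{i,j} = [x^i] d(x) h(x)^j`. -/
noncomputable def riordanMatrix {K : Type*} [Field K] (d h : PowerSeries K) : Matrix ℕ ℕ K :=
  Matrix.of fun i j => coeff i (d * h ^ j)

open PowerSeries in
/-- `A` is a Riordan matrix: `A = (d, h)` with `d` invertible for the Cauchy product and
`h` invertible for composition, that is, `d_0 ≠ 0`, `h_0 = 0` and `h_1 ≠ 0`. -/
def IsRiordan {K : Type*} [Field K] (A : Matrix ℕ ℕ K) : Prop :=
  ∃ d h : PowerSeries K, coeff 0 d ≠ 0 ∧ coeff 0 h = 0 ∧ coeff 1 h ≠ 0 ∧ A = riordanMatrix d h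

/-- The matrix product of infinite lower triangular matrices. Row `i` of `A` vanishes beyond
column `i`, so this is the usual row-by-column product. -/
def lowerMul {K : Type*} [Field K] (A B : Matrix ℕ ℕ K) : Matrix ℕ ℕ K :=
  Matrix.of fun i j => ∑ k ∈ Finset.range (i + 1), A i k * B k j

/-- The underlying set of the Riordan group `R(K)`. -/
@[ext]
structure RiordanGroup (K : Type*) [Field K] where
  /-- The underlying infinite matrix. -/
  val : Matrix ℕ ℕ K
  /-- The matrix is a Riordan matrix. -/
  isRiordan : IsRiordan val

section helpers

open PowerSeries

variable {K : Type*} [Field K]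

theorem coeff_pow_eq_zero_of_lt {h : PowerSeries K} (h0 : coeff 0 h = 0) {i j : ℕ} (hij : i < j) :
    coeff i (h ^ j) = 0 := by
  have hX : X ∣ h := by
    rw [X_dvd_iff, ← coeff_zero_eq_constantCoeff_apply]
    exact h0
  exact X_pow_dvd_iff.1 (pow_dvd_pow_of_dvd hX j) i hij

theorem hasSubst_of_coeff_zero {h : PowerSeries K} (h0 : coeff 0 h = 0) : HasSubst h :=
  HasSubst.of_constantCoeff_zero' (by rw [← coeff_zero_eq_constantCoeff_apply]; exact h0)

theorem IsRiordan.lower {A : Matrix ℕ ℕ K} (hA : IsRiordan A) {i j : ℕ} (hij : i < j) :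
    A i j = 0 := by
  obtain ⟨d, h, -, h0, -, rfl⟩ := hA
  have hX : X ∣ h := by
    rw [X_dvd_iff, ← coeff_zero_eq_constantCoeff_apply]
    exact h0
  exact X_pow_dvd_iff.1 ((pow_dvd_pow_of_dvd hX j).mul_left d) i hij

theorem coeff_subst_eq_sum {h : PowerSeries K} (h0 : coeff 0 h = 0) (f : PowerSeries K)
    {q i : ℕ} (hq : q ≤ i) :
    coeff q (f.subst h) = ∑ k ∈ Finset.range (i + 1), coeff k f * coeff q (h ^ k) := by
  rw [coeff_subst' (hasSubst_of_coeff_zero h0)]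
  refine finsum_eq_sum_of_support_subset _ fun k hk => ?_
  by_contra hk'
  apply hk
  simp only [Finset.coe_range, Set.mem_Iio, not_lt] at hk'
  simp [coeff_pow_eq_zero_of_lt h0 (show q < k by omega)]

theorem riordanMatrix_action {d h : PowerSeries K} (h0 : coeff 0 h = 0) (f : PowerSeries K)
    (i : ℕ) :
    ∑ k ∈ Finset.range (i + 1), riordanMatrix d h i k * coeff k f = coeff i (d * f.subst h) := by
  rw [coeff_mul]
  simp only [riordanMatrix, Matrix.of_apply, coeff_mul, Finset.sum_mul]
  rw [Finset.sum_comm]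
  refine Finset.sum_congr rfl fun p hp => ?_
  have hp' : p.2 ≤ i := by
    have := Finset.HasAntidiagonal.mem_antidiagonal.1 hp
    omega
  rw [coeff_subst_eq_sum h0 f hp', Finset.mul_sum]
  exact Finset.sum_congr rfl fun k _ => by ring

theorem lowerMul_riordanMatrix {d h l m : PowerSeries K} (h0 : coeff 0 h = 0) :
    lowerMul (riordanMatrix d h) (riordanMatrix l m) =
      riordanMatrix (d * l.subst h) (m.subst h) := by
  ext i j
  have hs := hasSubst_of_coeff_zero h0
  have := riordanMatrix_action (d := d) h0 (l * m ^ j) i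
  rw [subst_mul hs, subst_pow hs, ← mul_assoc] at this
  exact this

theorem coeff_zero_subst_eq {h : PowerSeries K} (h0 : coeff 0 h = 0) (f : PowerSeries K) :
    coeff 0 (f.subst h) = coeff 0 f := by
  rw [coeff_subst_eq_sum h0 f le_rfl]
  simp

theorem coeff_one_subst_eq {h : PowerSeries K} (h0 : coeff 0 h = 0) (f : PowerSeries K) :
    coeff 1 (f.subst h) = coeff 1 f * coeff 1 h := by
  rw [coeff_subst_eq_sum h0 f le_rfl]
  simp [Finset.sum_range_succ, coeff_one]

theorem IsRiordan.mul {A B : Matrix ℕ ℕ K} (hA : IsRiordan A) (hB : IsRiordan B) :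
    IsRiordan (lowerMul A B) := by
  obtain ⟨d, h, d0, h0, h1, rfl⟩ := hA
  obtain ⟨l, m, l0, m0, m1, rfl⟩ := hB
  refine ⟨_, _, ?_, ?_, ?_, lowerMul_riordanMatrix h0⟩
  · have hz : coeff 0 (d * l.subst h) = coeff 0 d * coeff 0 (l.subst h) := by simp [coeff_mul]
    rw [hz, coeff_zero_subst_eq h0]
    exact mul_ne_zero d0 l0
  · rw [coeff_zero_subst_eq h0, m0]
  · rw [coeff_one_subst_eq h0]
    exact mul_ne_zero m1 h1

theorem riordanMatrix_one_X : riordanMatrix (1 : PowerSeries K) X = 1 := by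
  ext i j
  simp [riordanMatrix, coeff_X_pow, Matrix.one_apply]

theorem isRiordan_one : IsRiordan (1 : Matrix ℕ ℕ K) :=
  ⟨1, X, by simp, by simp, by simp, riordanMatrix_one_X.symm⟩

theorem lowerMul_one (A : Matrix ℕ ℕ K) (hA : IsRiordan A) : lowerMul A 1 = A := by
  ext i j
  simp only [lowerMul, Matrix.of_apply, Matrix.one_apply, mul_ite, mul_one, mul_zero,
    Finset.sum_ite_eq', Finset.mem_range]
  split_ifs with h
  · rfl
  · exact (hA.lower (by omega)).symm

theorem one_lowerMul (A : Matrix ℕ ℕ K) : lowerMul 1 A = A := by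
  ext i j
  simp [lowerMul, Matrix.one_apply]

theorem lowerMul_eq_sum_range {A : Matrix ℕ ℕ K} (hA : IsRiordan A) (B : Matrix ℕ ℕ K)
    {i N : ℕ} (hi : i ≤ N) (j : ℕ) :
    lowerMul A B i j = ∑ k ∈ Finset.range (N + 1), A i k * B k j := by
  refine Finset.sum_subset (Finset.range_mono (by omega)) fun k _ hk => ?_
  rw [hA.lower (by simpa using hk), zero_mul]

theorem lowerMul_assoc (A : Matrix ℕ ℕ K) {B : Matrix ℕ ℕ K} (C : Matrix ℕ ℕ K)
    (hB : IsRiordan B) : lowerMul (lowerMul A B) C = lowerMul A (lowerMul B C) := by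
  ext i j
  have h2 : ∀ k ∈ Finset.range (i + 1), A i k * lowerMul B C k j =
      ∑ q ∈ Finset.range (i + 1), A i k * B k q * C q j := fun k hk => by
    rw [lowerMul_eq_sum_range hB C (Nat.lt_succ_iff.1 (Finset.mem_range.1 hk)), Finset.mul_sum]
    exact Finset.sum_congr rfl fun q _ => by ring
  change ∑ q ∈ Finset.range (i + 1), (∑ k ∈ Finset.range (i + 1), A i k * B k q) * C q j =
    ∑ k ∈ Finset.range (i + 1), A i k * lowerMul B C k j
  rw [Finset.sum_congr rfl h2, Finset.sum_comm]
  exact Finset.sum_congr rfl fun q _ => Finset.sum_mul _ _ _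

theorem IsRiordan.exists_left_inv {A : Matrix ℕ ℕ K} (hA : IsRiordan A) :
    ∃ B : Matrix ℕ ℕ K, IsRiordan B ∧ lowerMul B A = 1 := by
  obtain ⟨d, h, d0, h0, h1, rfl⟩ := hA
  have hu : IsUnit (coeff 1 h) := isUnit_iff_ne_zero.2 h1
  set m := h.substInvOfIsUnit hu with hm
  have hc : constantCoeff h = 0 := by rw [← coeff_zero_eq_constantCoeff_apply]; exact h0
  have m0 : coeff 0 m = 0 := by
    rw [coeff_zero_eq_constantCoeff_apply]; exact constantCoeff_substInvOfIsUnit h hu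
  have hmh : h.subst m = X := subst_substInvOfIsUnit_right h hc hu
  have m1 : coeff 1 m ≠ 0 := by
    intro hz
    have := congrArg (coeff 1) hmh
    rw [coeff_one_subst_eq m0, hz] at this
    simp at this
  have hdm : constantCoeff (d.subst m) ≠ 0 := by
    rw [← coeff_zero_eq_constantCoeff_apply, coeff_zero_subst_eq m0]
    exact d0
  refine ⟨riordanMatrix (d.subst m)⁻¹ m, ⟨_, m, ?_, m0, m1, rfl⟩, ?_⟩
  · rw [coeff_zero_eq_constantCoeff_apply, constantCoeff_inv]
    exact inv_ne_zero hdm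
  · rw [lowerMul_riordanMatrix m0, hmh, PowerSeries.inv_mul_cancel _ hdm, riordanMatrix_one_X]

end helpers

/-- The Riordan group: Riordan matrices with the matrix product and the identity matrix. -/
noncomputable instance {K : Type*} [Field K] : Group (RiordanGroup K) :=
  letI : Mul (RiordanGroup K) := ⟨fun A B => ⟨lowerMul A.val B.val, A.isRiordan.mul B.isRiordan⟩⟩
  letI : One (RiordanGroup K) := ⟨⟨1, isRiordan_one⟩⟩
  letI : Inv (RiordanGroup K) :=
    ⟨fun A => ⟨A.isRiordan.exists_left_inv.choose, A.isRiordan.exists_left_inv.choose_spec.1⟩⟩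
  Group.ofLeftAxioms
    (fun A B C => RiordanGroup.ext (lowerMul_assoc A.val C.val B.isRiordan))
    (fun A => RiordanGroup.ext (one_lowerMul A.val))
    (fun A => RiordanGroup.ext A.isRiordan.exists_left_inv.choose_spec.2)

theorem RiordanGroup.one_val {K : Type*} [Field K] : (1 : RiordanGroup K).val = 1 := rfl

theorem RiordanGroup.mul_val {K : Type*} [Field K] (A B : RiordanGroup K) :
    (A * B).val = lowerMul A.val B.val := rfl

/-- The truncation `(d_{i,j})_{i,j ∈ ℕ} ↦ (d_{i,j})_{0 ≤ i,j ≤ n}`, as a homomorphism into the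
multiplicative monoid of square matrices of size `n + 1`. -/
def riordanTruncMatrix (K : Type*) [Field K] (n : ℕ) :
    RiordanGroup K →* Matrix (Fin (n + 1)) (Fin (n + 1)) K where
  toFun A := Matrix.of fun i j => A.val i j
  map_one' := by
    ext i j
    simp [RiordanGroup.one_val, Matrix.one_apply, Fin.ext_iff]
  map_mul' A B := by
    ext i j
    simp only [Matrix.of_apply, Matrix.mul_apply, RiordanGroup.mul_val]
    rw [lowerMul_eq_sum_range A.isRiordan B.val (Nat.lt_succ_iff.1 i.2),
      Finset.sum_range fun k => A.val i k * B.val k j]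

/-- The homomorphism `Π_n : R(K) → GL(n + 1, K)`. -/
noncomputable def riordanTrunc (K : Type*) [Field K] (n : ℕ) :
    RiordanGroup K →* Matrix.GeneralLinearGroup (Fin (n + 1)) K :=
  (riordanTruncMatrix K n).toHomUnits

/-- The group `R_n(K) = Π_n(R(K))` of finite Riordan matrices of size `n + 1`. -/
noncomputable def riordanFin (K : Type*) [Field K] (n : ℕ) :
    Subgroup (Matrix.GeneralLinearGroup (Fin (n + 1)) K) :=
  (riordanTrunc K n).range

/-- An involution of a group: an element of order two. -/
def IsInvolution {G : Type*} [Group G] (g : G) : Prop := g ≠ 1 ∧ g * g = 1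

/-- Every element of the subgroup generated by the involutions of `G` is a product of at most
four involutions of `G` (the empty product being the identity). -/
def FourInvolutionProperty (G : Type*) [Group G] : Prop :=
  ∀ g ∈ Subgroup.closure {s : G | IsInvolution s},
    ∃ l : List G, l.length ≤ 4 ∧ (∀ s ∈ l, IsInvolution s) ∧ l.prod = g

section FourInvolutions

open PowerSeries

variable {K : Type*} [Field K]

/-! For `(d, h)` the invariant is `d₀² = h₁² = 1` together with `h₁h₃ = h₂²`, the vanishing at `0`
of the Schwarzian derivative of `h`. These conditions are stable under products (`signedMobius`) and
hold for involutions; for truncations with `n < 3` a lift satisfying them is chosen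
(`exists_mem_signedMobius`). So everything generated by involutions satisfies them.

Conversely, suppose `h₁ = -1`. One involution with a Möbius second component turns the element into
one with `d₀ = 1`, `d₁ = 0`, `h₁ = h₂ = h₃ = 1`. Such an element is conjugate to `(1, X/(1+X))`, a
product of two involutions (`exists_mul_of_tangent`), so three suffice. If `h₁ = 1`, multiplying by
`(1, -X)` reduces to this case at the cost of a fourth. -/

/-! ### Low-order coefficients and products of series pairs -/

theorem coeff_two_subst_eq {h : PowerSeries K} (h0 : coeff 0 h = 0) (f : PowerSeries K) :
    coeff 2 (f.subst h) = coeff 1 f * coeff 2 h + coeff 2 f * coeff 1 h ^ 2 := by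
  rw [coeff_subst_eq_sum h0 f le_rfl]
  have h0' : constantCoeff h = 0 := by simpa using h0
  simp [Finset.sum_range_succ, coeff_one, pow_succ, coeff_mul,
    Finset.Nat.antidiagonal_succ, h0']

theorem coeff_three_subst_eq {h : PowerSeries K} (h0 : coeff 0 h = 0) (f : PowerSeries K) :
    coeff 3 (f.subst h) = coeff 1 f * coeff 3 h + 2 * coeff 2 f * coeff 1 h * coeff 2 h +
      coeff 3 f * coeff 1 h ^ 3 := by
  rw [coeff_subst_eq_sum h0 f le_rfl]
  have h0' : constantCoeff h = 0 := by simpa using h0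
  simp [Finset.sum_range_succ, coeff_one, pow_succ, coeff_mul,
    Finset.Nat.antidiagonal_succ, h0']
  ring

theorem coeff_one_mul_eq (f g : PowerSeries K) :
    coeff 1 (f * g) = coeff 0 f * coeff 1 g + coeff 1 f * coeff 0 g := by
  simp [coeff_mul, Finset.Nat.antidiagonal_succ]

theorem coeff_zero_mul_eq (f g : PowerSeries K) :
    coeff 0 (f * g) = coeff 0 f * coeff 0 g := by
  simp [coeff_mul]

/-- The element `(d, h)` of the Riordan group. -/
noncomputable def RiordanGroup.ofSeries (d h : PowerSeries K) (d0 : coeff 0 d ≠ 0) (h0 : coeff 0 h = 0)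
    (h1 : coeff 1 h ≠ 0) : RiordanGroup K :=
  ⟨riordanMatrix d h, d, h, d0, h0, h1, rfl⟩

theorem RiordanGroup.exists_ofSeries (A : RiordanGroup K) :
    ∃ d h d0 h0 h1, A = RiordanGroup.ofSeries d h d0 h0 h1 := by
  obtain ⟨A, d, h, d0, h0, h1, hA⟩ := A
  exact ⟨d, h, d0, h0, h1, RiordanGroup.ext hA⟩

theorem RiordanGroup.ofSeries_mul {d h l m : PowerSeries K} (d0 : coeff 0 d ≠ 0)
    (h0 : coeff 0 h = 0) (h1 : coeff 1 h ≠ 0) (l0 : coeff 0 l ≠ 0)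
    (m0 : coeff 0 m = 0) (m1 : coeff 1 m ≠ 0) :
    (ofSeries d h d0 h0 h1 * ofSeries l m l0 m0 m1).val =
      riordanMatrix (d * l.subst h) (m.subst h) :=
  lowerMul_riordanMatrix h0

/-! ### Linear functional equations, solved coefficient by coefficient -/

/-- A linear system whose first subdiagonal does not vanish from row `r` on is solvable. -/
theorem exists_subdiagonal_solution (M : ℕ → ℕ → K) (t : ℕ → K) (r : ℕ)
    (hM : ∀ i, r ≤ i → M (i + 1) i ≠ 0) :
    ∃ f : ℕ → K, (∀ k < r, f k = 0) ∧
      ∀ i, r ≤ i → ∑ k ∈ Finset.range (i + 1), M (i + 1) k * f k = t (i + 1) := by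
  let f : ℕ → K := fun i => Nat.strongRec (motive := fun _ => K)
    (fun i F => if i < r then 0 else
      (t (i + 1) - ∑ k : Fin i, M (i + 1) k * F k k.2) / M (i + 1) i) i
  have hf : ∀ i, f i = if i < r then 0 else
      (t (i + 1) - ∑ k : Fin i, M (i + 1) k * f k) / M (i + 1) i := fun i => by
    simp only [f]
    conv_lhs => rw [Nat.strongRec_eq]
  refine ⟨f, fun k hk => by rw [hf, if_pos hk], fun i hi => ?_⟩
  rw [Finset.sum_range_succ, hf i, if_neg (by omega), mul_div_cancel₀ _ (hM i hi),
    Finset.sum_range fun k => M (i + 1) k * f k]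
  ring

theorem coeff_succ_mul_pow {d h : PowerSeries K} (h0 : coeff 0 h = 0) (h1 : coeff 1 h = 1)
    (j : ℕ) :
    coeff (j + 1) (d * h ^ j) = coeff 1 d + j * coeff 0 d * coeff 2 h := by
  obtain ⟨g, rfl⟩ : X ∣ h := by rw [X_dvd_iff]; simpa using h0
  have hg : coeff 0 g = 1 := by simpa [coeff_succ_X_mul] using h1
  have e : d * (X * g) ^ j = X ^ j * (d * g ^ j) := by ring
  have hp : coeff 1 (g ^ j) = j * coeff 1 g := by
    rw [coeff_one_pow]
    simp at hg
    simp [hg]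
  have h2 : coeff 2 (X * g) = coeff 1 g := coeff_succ_X_mul 1 g
  simp at hg
  rw [e, add_comm, coeff_X_pow_mul, coeff_one_mul_eq, hp, h2]
  simp [hg]
  ring

/-- Solvability of `d f(h) - e f = t` for a tangent-to-identity `h`. -/
theorem exists_subst_eq {d e h t : PowerSeries K} (r : ℕ) (h0 : coeff 0 h = 0)
    (h1 : coeff 1 h = 1) (hde : coeff 0 d = coeff 0 e)
    (hr : ∀ i, r ≤ i → coeff 1 d + i * coeff 0 d * coeff 2 h ≠ coeff 1 e)
    (ht : ∀ i ≤ r, coeff i t = 0) :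
    ∃ f : PowerSeries K, (∀ k < r, coeff k f = 0) ∧ d * f.subst h - e * f = t := by
  have eX : ∀ f : PowerSeries K, f.subst (X : PowerSeries K) = f := fun f => by
    rw [← map_algebraMap_eq_subst_X (S := K)]; simp
  have hX0 : coeff 0 (X : PowerSeries K) = 0 := by simp
  -- Matrix of `f ↦ d f(h) - e f`. It is strictly lower triangular, since `d₀ = e₀` and `h₁ = 1`, so
  -- the equation in degree `i + 1` determines `f_i`.
  let M : ℕ → ℕ → K := fun i k => riordanMatrix d h i k - riordanMatrix e X i k
  have hdiag : ∀ i, M i i = 0 := fun i => by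
    obtain ⟨g, rfl⟩ : X ∣ h := by rw [X_dvd_iff]; simpa using h0
    have hg : coeff 0 g = 1 := by simpa [coeff_succ_X_mul] using h1
    have e1 : d * (X * g) ^ i = X ^ i * (d * g ^ i) := by ring
    simp at hg hde
    simp [M, riordanMatrix, e1, mul_comm e, coeff_X_pow_mul', hg, hde]
  have hup : ∀ i k, i < k → M i k = 0 := fun i k hik => by
    obtain ⟨g, rfl⟩ : X ∣ h := by rw [X_dvd_iff]; simpa using h0
    have e1 : d * (X * g) ^ k = X ^ k * (d * g ^ k) := by ring
    simp [M, riordanMatrix, e1, mul_comm e, coeff_X_pow_mul', hik.not_ge]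
  have hsub : ∀ i, r ≤ i → M (i + 1) i ≠ 0 := fun i hi => by
    have := coeff_succ_mul_pow (d := e) (h := X) (by simp) (by simp) i
    simp only [M, riordanMatrix, Matrix.of_apply, coeff_succ_mul_pow h0 h1, this]
    simpa [coeff_X, sub_ne_zero] using hr i hi
  obtain ⟨f, hf0, hf⟩ := exists_subdiagonal_solution M (fun i => coeff i t) r hsub
  refine ⟨mk f, fun k hk => by simpa using hf0 k hk, ?_⟩
  ext i
  have key : coeff i (d * (mk f).subst h - e * mk f) =
      ∑ k ∈ Finset.range (i + 1), M i k * f k := by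
    have h2 := riordanMatrix_action (d := e) hX0 (mk f) i
    rw [eX] at h2
    rw [map_sub, ← riordanMatrix_action h0, ← h2, ← Finset.sum_sub_distrib]
    exact Finset.sum_congr rfl fun k _ => by simp [M, sub_mul]
  rw [key]
  rcases le_or_gt i r with hi | hi
  · rw [ht i hi]
    refine Finset.sum_eq_zero fun k hk => ?_
    rcases lt_or_ge k r with hk' | hk'
    · rw [hf0 k hk', mul_zero]
    · obtain rfl : k = i := by simp at hk; omega
      rw [hdiag, zero_mul]
  · obtain ⟨i, rfl⟩ := Nat.exists_eq_succ_of_ne_zero (show i ≠ 0 by omega)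
    rw [Finset.sum_range_succ, Nat.succ_eq_add_one, hdiag, zero_mul, add_zero]
    exact hf i (by omega)

/-! ### Möbius involutions and the normal form -/

theorem RiordanGroup.ofSeries_val {d h : PowerSeries K} (d0 : coeff 0 d ≠ 0)
    (h0 : coeff 0 h = 0) (h1 : coeff 1 h ≠ 0) :
    (ofSeries d h d0 h0 h1).val = riordanMatrix d h := rfl

/-- The involution `(1, -X)`. -/
noncomputable def RiordanGroup.reflection (K : Type*) [Field K] : RiordanGroup K :=
  ofSeries 1 (-X) (by simp) (by simp) (by simp)

theorem subst_neg_X_mul_self : (-X : PowerSeries K).subst (-X : PowerSeries K) = X := by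
  have hs : HasSubst (-X : PowerSeries K) := hasSubst_of_coeff_zero (by simp)
  rw [← coe_substAlgHom hs, map_neg, coe_substAlgHom hs, subst_X hs, neg_neg]

theorem subst_one_eq {h : PowerSeries K} (h0 : coeff 0 h = 0) :
    (1 : PowerSeries K).subst h = 1 := by
  have hs := hasSubst_of_coeff_zero h0
  rw [← coe_substAlgHom hs, map_one]

theorem RiordanGroup.reflection_mul_self : reflection K * reflection K = 1 := by
  refine RiordanGroup.ext ?_
  rw [reflection, ofSeries_mul, subst_one_eq (by simp), subst_neg_X_mul_self, one_mul,
    riordanMatrix_one_X, one_val]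

/-- The involutive Möbius series `-X / (1 + c X)`. -/
noncomputable def mobiusInvolution (c : K) : PowerSeries K := -X * (1 + C c * X)⁻¹

theorem mobiusInvolution_mul (c : K) : mobiusInvolution c * (1 + C c * X) = -X := by
  rw [mobiusInvolution, mul_assoc, PowerSeries.inv_mul_cancel _ (by simp), mul_one]

theorem coeff_zero_mobiusInvolution (c : K) : coeff 0 (mobiusInvolution c) = 0 := by
  simp [mobiusInvolution]

theorem coeff_one_mobiusInvolution (c : K) : coeff 1 (mobiusInvolution c) = -1 := by
  rw [mobiusInvolution, coeff_one_mul_eq]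
  simp

theorem coeff_two_mobiusInvolution (c : K) : coeff 2 (mobiusInvolution c) = c := by
  have h := congrArg (coeff 2) (mobiusInvolution_mul c)
  rw [mul_add, mul_one, ← mul_assoc, map_add, coeff_succ_mul_X, mul_comm, coeff_C_mul,
    coeff_one_mobiusInvolution] at h
  simp [coeff_X] at h
  linear_combination h

theorem coeff_three_mobiusInvolution (c : K) : coeff 3 (mobiusInvolution c) = -c ^ 2 := by
  have h := congrArg (coeff 3) (mobiusInvolution_mul c)
  rw [mul_add, mul_one, ← mul_assoc, map_add, coeff_succ_mul_X, mul_comm, coeff_C_mul,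
    coeff_two_mobiusInvolution] at h
  simp [coeff_X] at h
  linear_combination h

theorem mobiusInvolution_subst_self (c : K) :
    (mobiusInvolution c).subst (mobiusInvolution c) = X := by
  have hs := hasSubst_of_coeff_zero (coeff_zero_mobiusInvolution c)
  have h := congrArg (substAlgHom hs) (mobiusInvolution_mul c)
  have hC : substAlgHom hs (C c) = C c := by
    rw [show (C c : PowerSeries K) = algebraMap K _ c from rfl, AlgHom.commutes]
  simp only [map_mul, map_add, map_one, map_neg, hC, substAlgHom_X hs] at h
  rw [coe_substAlgHom hs] at h
  have hne : (1 + C c * mobiusInvolution c : PowerSeries K) ≠ 0 := fun hz => by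
    have := congrArg (coeff 0) hz
    simp [mobiusInvolution] at this
  have hm := mobiusInvolution_mul c
  refine mul_right_cancel₀ hne ?_
  rw [h]
  linear_combination -hm

/-- The tangent-to-identity normal form `(1, X / (1 + X))`. -/
noncomputable def RiordanGroup.normalForm (K : Type*) [Field K] : RiordanGroup K :=
  ofSeries 1 (-mobiusInvolution 1) (by simp) (by simp [mobiusInvolution])
    (by rw [map_neg, coeff_one_mobiusInvolution]; simp)

theorem RiordanGroup.normalForm_eq_mul :
    ∃ w₁ w₂ : RiordanGroup K, w₁ * w₁ = 1 ∧ w₂ * w₂ = 1 ∧ normalForm K = w₁ * w₂ := by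
  have m0 := coeff_zero_mobiusInvolution (1 : K)
  refine ⟨ofSeries 1 (mobiusInvolution 1) (by simp) m0
    (by rw [coeff_one_mobiusInvolution]; simp), reflection K, RiordanGroup.ext ?_,
    reflection_mul_self, RiordanGroup.ext ?_⟩
  · rw [ofSeries_mul, subst_one_eq m0, mobiusInvolution_subst_self, one_mul,
      riordanMatrix_one_X, one_val]
  · have hs := hasSubst_of_coeff_zero m0
    rw [reflection, ofSeries_mul, subst_one_eq m0, one_mul, normalForm, ofSeries_val,
      ← coe_substAlgHom hs, map_neg, substAlgHom_X hs]

/-! ### Conjugation to the normal form -/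

/-- The Fatou coordinate: `h` is conjugate to `X / (1 + X)`. -/
theorem exists_conj_mobius [CharZero K] {h : PowerSeries K} (h0 : coeff 0 h = 0) (h1 : coeff 1 h = 1)
    (h2 : coeff 2 h ≠ 0) (h3 : coeff 3 h = coeff 2 h ^ 2) :
    ∃ k : PowerSeries K, coeff 0 k = 0 ∧ coeff 1 k ≠ 0 ∧
      k.subst h = (-mobiusInvolution (1 : K)).subst k := by
  obtain ⟨g, hg⟩ : X ∣ h := by rw [X_dvd_iff]; simpa using h0
  have hgc : ∀ i, coeff i g = coeff (i + 1) h := fun i => by rw [hg, coeff_succ_X_mul]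
  set a := coeff 2 h with ha
  have hs := hasSubst_of_coeff_zero h0
  -- The conjugacy says `1/k(h) = 1/k + 1`. With `k = X/ψ` and `h = X g` it becomes `ψ(h) = g ψ +
  -- h`; substituting `ψ = f - a⁻¹` gives this equation for `f`. The subdiagonal entry `(i - 1)a`
  -- vanishes at `i = 1`, hence `r = 2`; the compatibility condition in degree 2 is exactly `h₃ =
  -- h₂²`.
  obtain ⟨f, hf0, hf⟩ := exists_subst_eq (d := 1) (e := g) (h := h)
    (t := h + C a⁻¹ * (1 - g)) 2 h0 h1 (by rw [hgc]; simp [h1]) (fun i hi => by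
      have : (i : K) ≠ 1 := by exact_mod_cast (by omega : i ≠ 1)
      rw [hgc, ← ha]
      simpa [coeff_one] using fun e => this (mul_right_cancel₀ h2 (by rw [e, one_mul])))
    (fun i hi => by
      rw [map_add, coeff_C_mul, map_sub, hgc]
      interval_cases i
      · simp [h0, h1]
      · simp [coeff_one, h1, ← ha, h2]
      · simp [coeff_one, h3, ← ha]
        field_simp
        ring)
  set ψ : PowerSeries K := f - C a⁻¹ with hψ
  have hψ0 : constantCoeff ψ = -a⁻¹ := by
    have := hf0 0 (by norm_num)
    simp at this
    simp [hψ, this]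
  have hψne : constantCoeff ψ ≠ 0 := by rw [hψ0]; simpa using h2
  have hC : ∀ (u : PowerSeries K) (hu : HasSubst u) (c : K), substAlgHom hu (C c) = C c :=
    fun u hu c => by
      rw [show (C c : PowerSeries K) = algebraMap K _ c from rfl, AlgHom.commutes]
  have hψh : substAlgHom hs ψ = g * ψ + h := by
    rw [hψ, map_sub, hC, coe_substAlgHom hs]
    linear_combination hf
  have hk : X * ψ⁻¹ * ψ = X := by rw [mul_assoc, PowerSeries.inv_mul_cancel _ hψne, mul_one]
  set k := X * ψ⁻¹ with hkdef
  have k0 : coeff 0 k = 0 := by simp [hkdef]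
  refine ⟨k, k0, ?_, ?_⟩
  · rw [hkdef, coeff_one_mul_eq]
    simpa [constantCoeff_inv] using hψne
  have hks := hasSubst_of_coeff_zero k0
  have e1 := congrArg (substAlgHom hs) hk
  have e2 := congrArg (substAlgHom hks) (mobiusInvolution_mul (1 : K))
  rw [← coe_substAlgHom hs, ← coe_substAlgHom hks, map_neg]
  simp only [map_mul, map_add, map_one, map_neg, one_mul, substAlgHom_X, hψh] at e1 e2
  have hsum : ψ + X ≠ 0 := fun hz => by
    have := congrArg constantCoeff hz
    simp at this
    exact hψne this
  have hgne : g ≠ 0 := fun hz => by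
    have := hgc 0
    rw [hz, h1] at this
    simp at this
  refine mul_right_cancel₀ (mul_ne_zero hgne hsum) ?_
  linear_combination e1 - (substAlgHom hs k - 1) * hg +
    g * (ψ * e2 - (substAlgHom hks (mobiusInvolution (1 : K)) + 1) * hk)

namespace RiordanGroup

/-- Conjugating by `P = (1 + f, k)` reaches the normal form: `k` linearizes the second component,
and `d · (1 + f)(h) = 1 + f` removes the first. The latter is obstructed only in degree 1, where `d₁
= 0` is needed. -/
theorem exists_mul_of_tangent [CharZero K] {d h : PowerSeries K} (d0 : coeff 0 d = 1)
    (d1 : coeff 1 d = 0) (h0 : coeff 0 h = 0) (h1 : coeff 1 h = 1)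
    (h2 : coeff 2 h ≠ 0) (h3 : coeff 3 h = coeff 2 h ^ 2) (A : RiordanGroup K)
    (hA : A.val = riordanMatrix d h) :
    ∃ w₁ w₂ : RiordanGroup K, w₁ * w₁ = 1 ∧ w₂ * w₂ = 1 ∧ A = w₁ * w₂ := by
  obtain ⟨k, k0, k1, hk⟩ := exists_conj_mobius h0 h1 h2 h3
  obtain ⟨f, hf0, hf⟩ := exists_subst_eq (d := d) (e := 1) (h := h) (t := 1 - d) 1 h0 h1
    (by simp [d0]) (fun i hi => by
      have : (i : K) ≠ 0 := by exact_mod_cast (by omega : i ≠ 0)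
      simp [coeff_one, d0, d1, h2, this])
    (fun i hi => by
      interval_cases i
      · rw [map_sub, d0]; simp
      · simp [coeff_one, d1])
  have F0 : coeff 0 (1 + f) ≠ 0 := by
    have := hf0 0 (by norm_num)
    simp at this
    simp [this]
  set P : RiordanGroup K := ofSeries (1 + f) k F0 k0 k1
  have hs := hasSubst_of_coeff_zero h0
  have hAP : A * P = P * normalForm K := by
    have eA : A = ofSeries d h (by simp [d0]) h0 (by simp [h1]) := RiordanGroup.ext hA
    refine RiordanGroup.ext ?_
    rw [eA, normalForm, ofSeries_mul, ofSeries_mul, hk, subst_one_eq k0,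
      ← coe_substAlgHom hs, map_add, map_one, coe_substAlgHom hs]
    congr 1
    linear_combination hf
  obtain ⟨w₁, w₂, hw₁, hw₂, hw⟩ := normalForm_eq_mul (K := K)
  refine ⟨P * w₁ * P⁻¹, P * w₂ * P⁻¹, ?_, ?_, ?_⟩
  · simp [mul_assoc, ← mul_assoc w₁, hw₁]
  · simp [mul_assoc, ← mul_assoc w₂, hw₂]
  · rw [eq_mul_inv_of_mul_eq hAP, hw]
    group

/-! ### Elements with vanishing Schwarzian at the origin -/

/-- The elements `(d, h)` with `d_0 = ± 1`, `h_1 = ± 1` and `h_1 h_3 = h_2 ^ 2`. -/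
def signedMobius (K : Type*) [Field K] : Submonoid (RiordanGroup K) where
  carrier := {A | ∃ d h : PowerSeries K, coeff 0 d ^ 2 = 1 ∧ coeff 0 h = 0 ∧
    coeff 1 h ^ 2 = 1 ∧ coeff 1 h * coeff 3 h = coeff 2 h ^ 2 ∧ A.val = riordanMatrix d h}
  one_mem' := ⟨1, X, by simp, by simp, by simp, by simp [coeff_X], riordanMatrix_one_X.symm⟩
  mul_mem' := by
    rintro A B ⟨d, h, d0, h0, h1, h3, hA⟩ ⟨l, m, l0, m0, m1, m3, hB⟩
    refine ⟨d * l.subst h, m.subst h, ?_, ?_, ?_, ?_, ?_⟩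
    · rw [coeff_zero_mul_eq, coeff_zero_subst_eq h0, mul_pow, d0, l0, one_mul]
    · rw [coeff_zero_subst_eq h0, m0]
    · rw [coeff_one_subst_eq h0, mul_pow, h1, m1, one_mul]
    · rw [coeff_one_subst_eq h0, coeff_two_subst_eq h0, coeff_three_subst_eq h0]
      linear_combination (coeff 1 m) ^ 2 * h3 + (coeff 1 h) ^ 4 * m3
    · rw [mul_val, hA, hB, lowerMul_riordanMatrix h0]

/-- An involutive Riordan element with prescribed leading coefficients. -/
theorem exists_reflection [CharZero K] (ε b c : K) (hε : ε ^ 2 = 1) :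
    ∃ (s : RiordanGroup K) (l : PowerSeries K), s * s = 1 ∧ coeff 0 l = ε ∧ coeff 1 l = b ∧
      s.val = riordanMatrix l (mobiusInvolution c) := by
  have m0 := coeff_zero_mobiusInvolution c
  have hs := hasSubst_of_coeff_zero m0
  set m := mobiusInvolution c with hm
  have m0' : constantCoeff m = 0 := by simpa using m0
  have hεne : ε ≠ 0 := by rintro rfl; simp at hε
  -- Take `l = ε(1 + βX)/(1 + βm)`: as `m(m) = X`, the fraction is inverted by substituting `m`, so
  -- `l · l(m) = ε² = 1`. Its linear coefficient is `2εβ`.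
  set β : K := b / (2 * ε)
  have hC : ∀ c : K, substAlgHom hs (C c) = C c := fun c => by
    rw [show (C c : PowerSeries K) = algebraMap K _ c from rfl, AlgHom.commutes]
  set v : PowerSeries K := (1 + C β * m)⁻¹ with hv
  have hv0 : constantCoeff v = 1 := by simp [hv, m0']
  have hvm : (1 + C β * m) * v = 1 := PowerSeries.mul_inv_cancel _ (by simp [m0'])
  have v1 : coeff 1 v = β := by
    have := congrArg (coeff 1) hvm
    rw [coeff_one_mul_eq, map_add, map_add, coeff_C_mul, coeff_C_mul, m0,
      coeff_one_mobiusInvolution] at this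
    simp [coeff_one, hv0] at this
    linear_combination this
  set l : PowerSeries K := C ε * ((1 + C β * X) * v) with hl
  have l0 : coeff 0 l = ε := by simp [hl, hv0]
  have l1 : coeff 1 l = b := by
    rw [hl, coeff_C_mul, coeff_one_mul_eq, v1, map_add, map_add, coeff_C_mul, coeff_C_mul]
    simp [coeff_one, hv0, β]
    field_simp
    ring
  refine ⟨ofSeries l m (by rw [l0]; exact hεne) m0 (by
    rw [coeff_one_mobiusInvolution]; simp), l, RiordanGroup.ext ?_, l0, l1, rfl⟩
  have hmm : substAlgHom hs m = X := by
    rw [coe_substAlgHom hs]; exact mobiusInvolution_subst_self c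
  have e := congrArg (substAlgHom hs) hvm
  simp only [map_mul, map_add, map_one, hC, hmm] at e
  rw [ofSeries_mul, one_val, ← riordanMatrix_one_X, ← coe_substAlgHom hs, hmm]
  congr 1
  rw [hl]
  simp only [map_mul, map_add, map_one, hC, substAlgHom_X hs]
  have hεC : (C ε : PowerSeries K) ^ 2 = 1 := by rw [← map_pow, hε, map_one]
  linear_combination hεC + (C ε) ^ 2 * e + (C ε) ^ 2 * (1 + C β * X) * substAlgHom hs v * hvm

theorem exists_three_of_neg [CharZero K] {d h : PowerSeries K} (d0 : coeff 0 d ^ 2 = 1)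
    (h0 : coeff 0 h = 0) (h1 : coeff 1 h = -1)
    (h3 : coeff 1 h * coeff 3 h = coeff 2 h ^ 2) (A : RiordanGroup K)
    (hA : A.val = riordanMatrix d h) :
    ∃ w₁ w₂ w₃ : RiordanGroup K, w₁ * w₁ = 1 ∧ w₂ * w₂ = 1 ∧ w₃ * w₃ = 1 ∧
      A = w₁ * w₂ * w₃ := by
  -- The choice of `l` makes the first component of `A * s` equal to `1 + O(X²)`; the parameter `h₂
  -- + 1` makes the quadratic coefficient of the second `-h₂ + (h₂ + 1) = 1`, which is nonzero as
  -- the normal form requires.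
  obtain ⟨s, l, hs, l0, l1, hsv⟩ := exists_reflection (coeff 0 d) (coeff 1 d)
    (coeff 2 h + 1) d0
  have hv : (A * s).val =
      riordanMatrix (d * l.subst h) ((mobiusInvolution (coeff 2 h + 1)).subst h) := by
    rw [mul_val, hA, hsv, lowerMul_riordanMatrix h0]
  have e2 : coeff 2 ((mobiusInvolution (coeff 2 h + 1)).subst h) = 1 := by
    rw [coeff_two_subst_eq h0, coeff_one_mobiusInvolution, coeff_two_mobiusInvolution, h1]
    ring
  obtain ⟨w₁, w₂, hw₁, hw₂, hw⟩ := exists_mul_of_tangent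
    (by rw [coeff_zero_mul_eq, coeff_zero_subst_eq h0, l0, ← pow_two, d0])
    (by rw [coeff_one_mul_eq, coeff_one_subst_eq h0, coeff_zero_subst_eq h0, l0, l1, h1]; ring)
    (by rw [coeff_zero_subst_eq h0, coeff_zero_mobiusInvolution])
    (by rw [coeff_one_subst_eq h0, coeff_one_mobiusInvolution, h1]; ring)
    (by rw [e2]; exact one_ne_zero)
    (by
      rw [e2, coeff_three_subst_eq h0, coeff_one_mobiusInvolution, coeff_two_mobiusInvolution,
        coeff_three_mobiusInvolution, h1]
      rw [h1] at h3
      linear_combination h3) (A * s) hv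
  refine ⟨w₁, w₂, s, hw₁, hw₂, hs, ?_⟩
  rw [← hw, mul_assoc, hs, mul_one]

theorem exists_list_of_mem_signedMobius [CharZero K] {A : RiordanGroup K}
    (hA : A ∈ signedMobius K) :
    ∃ l : List (RiordanGroup K), l.length ≤ 4 ∧ (∀ s ∈ l, s * s = 1) ∧ l.prod = A := by
  obtain ⟨d, h, d0, h0, h1, h3, hA⟩ := hA
  rcases mul_self_eq_one_iff.1 ((pow_two _).symm.trans h1) with h1 | h1
  · have hv : (A * reflection K).val = riordanMatrix d (-h) := by
      have hs := hasSubst_of_coeff_zero h0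
      rw [mul_val, hA, reflection, ofSeries_val, lowerMul_riordanMatrix h0, subst_one_eq h0,
        mul_one, ← coe_substAlgHom hs, map_neg, substAlgHom_X hs]
    obtain ⟨w₁, w₂, w₃, hw₁, hw₂, hw₃, hw⟩ := exists_three_of_neg d0 (by rw [map_neg, h0, neg_zero])
      (by rw [map_neg, h1]) (by simp only [map_neg]; linear_combination h3) _ hv
    refine ⟨[w₁, w₂, w₃, reflection K], by simp, ?_, ?_⟩
    · simp [hw₁, hw₂, hw₃, reflection_mul_self]
    · simp only [List.prod_cons, List.prod_nil, mul_one]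
      rw [← mul_assoc, ← mul_assoc, ← hw, mul_assoc, reflection_mul_self, mul_one]
  · obtain ⟨w₁, w₂, w₃, hw₁, hw₂, hw₃, hw⟩ := exists_three_of_neg d0 h0 h1 h3 A hA
    exact ⟨[w₁, w₂, w₃], by simp, by simp [hw₁, hw₂, hw₃], by simp [hw, mul_assoc]⟩

end RiordanGroup

/-! ### Transfer to the infinite and truncated groups -/

/-- Factors equal to `1` are dropped; they can arise, notably after passing to a quotient. -/
theorem List.exists_involutions {G : Type*} [Group G] (l : List G) (hl : ∀ s ∈ l, s * s = 1) :
    ∃ l' : List G, l'.length ≤ l.length ∧ (∀ s ∈ l', IsInvolution s) ∧ l'.prod = l.prod := by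
  classical
  refine ⟨l.filter (· ≠ 1), List.length_filter_le _ _, fun s hs => ?_, ?_⟩
  · rw [List.mem_filter] at hs
    exact ⟨by simpa using hs.2, hl s hs.1⟩
  · induction l with
    | nil => rfl
    | cons a l ih =>
      have ih := ih fun s hs => hl s (List.mem_cons_of_mem _ hs)
      by_cases ha : a = 1 <;> simp_all

theorem fourInvolutionProperty_of_hom [CharZero K] {G : Type*} [Group G]
    (φ : RiordanGroup K →* G)
    (hφ : ∀ s : G, IsInvolution s → s ∈ (RiordanGroup.signedMobius K).map φ) :
    FourInvolutionProperty G := by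
  intro g hg
  -- Involutions are their own inverses, so the subgroup they generate is already the submonoid they
  -- generate, and closure of `signedMobius` under products is enough.
  have hinv : {s : G | IsInvolution s}⁻¹ = {s : G | IsInvolution s} := by
    ext s
    simp only [Set.mem_inv, Set.mem_ofPred_eq, IsInvolution, ne_eq, inv_eq_one, ← mul_inv_rev]
  rw [← Subgroup.mem_toSubmonoid, Subgroup.closure_toSubmonoid, hinv, Set.union_self] at hg
  obtain ⟨A, hA, rfl⟩ := (Submonoid.closure_le.2 hφ) hg
  obtain ⟨l, hl4, hl, rfl⟩ := RiordanGroup.exists_list_of_mem_signedMobius hA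
  obtain ⟨l', hlen, hl', hprod⟩ := (l.map φ).exists_involutions (by
    simp only [List.mem_map, forall_exists_index, and_imp]
    rintro _ s hs rfl
    rw [← map_mul, hl s hs, map_one])
  exact ⟨l', by rw [List.length_map] at hlen; omega, hl', by rw [hprod, map_list_prod]⟩

/-- If the square of `(d, h)` agrees with the identity up to order `n ≥ 1`, then `(d, h)` agrees
up to order `n` with an element of `signedMobius`. -/
theorem RiordanGroup.exists_mem_signedMobius [CharZero K] (A : RiordanGroup K) {n : ℕ}
    (hn : 1 ≤ n) (hA : ∀ i ≤ n, ∀ j ≤ n, (A * A).val i j = (1 : Matrix ℕ ℕ K) i j) :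
    ∃ B ∈ signedMobius K, (3 ≤ n → B = A) ∧ ∀ i ≤ n, ∀ j ≤ n, B.val i j = A.val i j := by
  obtain ⟨d, h, d0, h0, h1, rfl⟩ := A.exists_ofSeries
  rw [ofSeries_mul, ← riordanMatrix_one_X] at hA
  have hd : ∀ i ≤ n, coeff i (d * d.subst h) = coeff i (1 : PowerSeries K) := fun i hi => by
    simpa [riordanMatrix] using hA i hi 0 (by omega)
  have hh : ∀ i ≤ n, coeff i (h.subst h) = coeff i (X : PowerSeries K) := fun i hi => by
    have h1 : coeff i (d * d.subst h * h.subst h) = coeff i (X : PowerSeries K) := by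
      simpa only [riordanMatrix, Matrix.of_apply, pow_one, one_mul] using hA i hi 1 hn
    rw [← h1, coeff_mul, ← one_mul (h.subst h), coeff_mul]
    refine Finset.sum_congr rfl fun p hp => ?_
    have := Finset.HasAntidiagonal.mem_antidiagonal.1 hp
    rw [hd p.1 (by omega), one_mul]
  have d2 : coeff 0 d ^ 2 = 1 := by
    have := hd 0 (by omega)
    rw [coeff_zero_mul_eq, coeff_zero_subst_eq h0] at this
    simpa [pow_two] using this
  have h2 : coeff 1 h ^ 2 = 1 := by
    have := hh 1 hn
    rw [coeff_one_subst_eq h0] at this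
    simpa [pow_two] using this
  by_cases hn3 : 3 ≤ n
  · refine ⟨_, ⟨d, h, d2, h0, h2, ?_, rfl⟩, fun _ => rfl, fun i _ j _ => rfl⟩
    have e2 := hh 2 (by omega)
    have e3 := hh 3 hn3
    rw [coeff_two_subst_eq h0] at e2
    rw [coeff_three_subst_eq h0] at e3
    simp only [coeff_X] at e2 e3
    norm_num at e2 e3
    rcases mul_self_eq_one_iff.1 ((pow_two _).symm.trans h2) with hh1 | hh1
    · rw [hh1] at e2 e3 ⊢
      have z2 : coeff 2 h = 0 := by linear_combination e2 / 2
      rw [z2] at e3 ⊢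
      linear_combination e3 / 2
    · rw [hh1] at e2 e3 ⊢
      linear_combination e3 / 2
  -- For `n ≤ 2` the truncation does not see `h₃`, so it may be reset to `h₁h₂²`.
  · set c : K := coeff 1 h * coeff 2 h ^ 2 - coeff 3 h with hc
    have hlow : ∀ i < 3, coeff i (h + C c * X ^ 3) = coeff i h := fun i hi => by
      rw [map_add, coeff_C_mul, coeff_X_pow, if_neg (by omega), mul_zero, add_zero]
    have h30 : coeff 3 (h + C c * X ^ 3) = coeff 1 h * coeff 2 h ^ 2 := by
      rw [map_add, coeff_C_mul, coeff_X_pow, if_pos rfl, hc]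
      ring
    have k0 : coeff 0 (h + C c * X ^ 3) = 0 := by rw [hlow 0 (by omega), h0]
    have k1 := hlow 1 (by omega)
    refine ⟨ofSeries d (h + C c * X ^ 3) d0 k0 (by rwa [k1]),
      ⟨d, _, d2, k0, by rw [k1, h2], ?_, rfl⟩, fun h => absurd h hn3, fun i hi j _ => ?_⟩
    · rw [k1, h30, hlow 2 (by omega)]
      linear_combination coeff 2 h ^ 2 * h2
    · obtain ⟨q, hq⟩ := sub_dvd_pow_sub_pow (h + C c * X ^ 3) h j
      rw [← sub_eq_zero, ofSeries_val, ofSeries_val, riordanMatrix, riordanMatrix,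
        Matrix.of_apply, Matrix.of_apply, ← map_sub, ← mul_sub, hq]
      have : d * ((h + C c * X ^ 3 - h) * q) = X ^ 3 * (d * C c * q) := by ring
      rw [this, coeff_X_pow_mul', if_neg (by omega)]

end FourInvolutions

theorem theorem1 (K : Type*) [Field K] [CharZero K] :
    FourInvolutionProperty (RiordanGroup K) ∧
      ∀ n : ℕ, 1 ≤ n → FourInvolutionProperty (riordanFin K n) := by
  constructor
  · refine fourInvolutionProperty_of_hom (MonoidHom.id _) fun s hs => ?_
    -- Order 3 is the least at which no correction of `h₃` is made, so `B = s`.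
    obtain ⟨B, hB, hBs, -⟩ := s.exists_mem_signedMobius (n := 3) (by omega) fun i _ j _ => by
      rw [hs.2, RiordanGroup.one_val]
    exact ⟨B, hB, hBs le_rfl⟩
  · intro n hn
    refine fourInvolutionProperty_of_hom (riordanTrunc K n).rangeRestrict fun s hs => ?_
    obtain ⟨A, rfl⟩ := (riordanTrunc K n).rangeRestrict_surjective s
    have hsq : riordanTruncMatrix K n (A * A) = riordanTruncMatrix K n 1 := by
      have h := (map_mul (riordanTrunc K n).rangeRestrict A A).trans
        (hs.2.trans (map_one (riordanTrunc K n).rangeRestrict).symm)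
      exact congrArg Units.val (congrArg Subtype.val h)
    have hentry : ∀ i ≤ n, ∀ j ≤ n, (A * A).val i j = (1 : Matrix ℕ ℕ K) i j :=
      fun i hi j hj => congrFun (congrFun hsq ⟨i, by omega⟩) ⟨j, by omega⟩
    obtain ⟨B, hB, -, hBA⟩ := A.exists_mem_signedMobius hn hentry
    refine ⟨B, hB, Subtype.ext (Units.ext (Matrix.ext fun i j => ?_))⟩
    exact hBA i (by omega) j (by omega)
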